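/- **Diagrams.** Let $\mathcal D$ be an oriented link diagram in the plane whose underlying 4-regular plane graph is connected and has at least one crossing. At a crossing $\chi$ let $F_0^\chi,F_1^\chi,F_2^\chi,F_3^\chi$ be the faces at its four angles, in counterclockwise order, where $F_0^\chi$ lies in the angle between the two incoming strands. A *state* is a map $\sigma$ from the set of faces to $\{0,1\}$ such that no two faces that share an edge both have the value $1$. Let $|\sigma_\chi|=8\sigma(F_0^\chi)+4\sigma(F_1^\chi)+2\sigma(F_2^\chi)+\sigma(F_3^\chi)\in\{0,1,2,4,5,8,10\}$. The state sum $[\mathcal D]$ is the sum over all states of the product of the following variables: $X_{|\sigma_\chi|}$ for each positive crossing $\chi$, $x_{|\sigma_\chi|}$ for each negative crossing $\chi$, $f_0$ for each face of value $0$, and $f_1$ for each face of value $1$. It is a polynomial in the 16 variables $f_0,f_1,x_i,X_i$ ($i\in\{0,1,2,4,5,8,10\}$), which may be specialized to elements of a commutative ring. **Curls.** Let $\mathcal D$ be obtained from $\mathcal D'$ by removing a curl (a Reidemeister move of type 1), where both diagrams are as above. The four types 1a–1d of curls are given by the sign of the crossing of the curl and by the sense (clockwise or counterclockwise) in which its loop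 is traversed. (The sense is the one seen with the face that the loop bounds inside the loop; equivalently, for a clockwise loop this face is $F_1^\chi$ at the crossing $\chi$ of the curl, and for a counterclockwise loop it is $F_3^\chi$.) **The ring.** Let $\mathcal I\subset\mathcal R=\mathbb Z[s,S]$ be the ideal generated by $1+s+s^2+s^3+s^4$, $1+S+S^2+S^3+S^4$ and $s^4+s^3S+s^2S^2+sS^3+S^4$, and let $\hat s,\hat S$ be the classes of $s,S$ in $\mathcal R/\mathcal I$. Consider the assignment $$f_0=\hat s^2\hat S^2,\quad f_1=\hat s^4+\hat S^4,\quad x_0=X_0=\hat s+\hat S,\quad x_1=x_4=\hat S,\quad X_1=X_4=\hat s,\quad x_2=x_8=\hat s,\quad X_2=X_8=\hat S,$$ $$x_5=X_{10}=-\hat s^2\hat S^4,\qquad x_{10}=X_5=-\hat s^4\hat S^2 .$$ **Lemma.** 1. Let the 16 variables be specialized to elements of a commutative ring such that $$f_0x_0+f_1x_4=f_0x_{10}=f_0x_1+f_1x_5,\qquad f_0X_0+f_1X_4=f_0X_{10}=f_0X_1+f_1X_5 .\tag{$*$}$$ If the loop of the curl is clockwise, or if $x_1=x_4$ and $X_1=X_4$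 (as in the assignment above), then $[\mathcal D']=f_0X_{10}\,[\mathcal D]$ if the crossing of the curl is positive, and $[\mathcal D']=f_0x_{10}\,[\mathcal D]$ if it is negative. 2. The assignment above satisfies $(*)$ in $\mathcal R/\mathcal I$. 3. Under this assignment in $\mathcal R/\mathcal I$, for each of the four types of curls, $[\mathcal D']=-\hat s^4\hat S\,[\mathcal D]$ if the crossing of the curl is positive, and $[\mathcal D']=-\hat s\hat S^4\,[\mathcal D]$ if it is negative. -/

import Mathlib

/-!
# The facial state sum of an oriented link diagram

A connected plane link diagram is encoded by its combinatorial map (rotation system).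
Around a crossing, the four half-edges are numbered `0, 1, 2, 3` counterclockwise in such a way
that `0` and `1` are the incoming ones, `2` and `3` the outgoing ones.  One strand enters by `0`
and leaves by `2`, the other one enters by `1` and leaves by `3`.  The corner (angle) number `i`
lies between the half-edges `i` and `i + 1` (mod 4); thus corner `0` is the distinguished angle
between the two incoming half-edges and corners `0, 1, 2, 3` follow each other counterclockwise.
-/

namespace FacialState

noncomputable section

/-- A half-edge of a 4-valent map with vertex set `X`. The same type numbers the corners:
the corner `(x, i)` is the one immediately counterclockwise after the half-edge `(x, i)`. -/
abbrev HalfEdge (X : Type*) := X × Fin 4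

/-- The two strands at a crossing. -/
inductive Strand
  /-- the strand from half-edge `0` to half-edge `2` -/
  | zeroTwo
  /-- the strand from half-edge `1` to half-edge `3` -/
  | oneThree
  deriving DecidableEq

/-- An oriented link diagram with crossing set `X` on some closed oriented surface:
the half-edges are glued in pairs to form the edges, every edge leads from an outgoing to an
incoming half-edge, and at each crossing one of the two strands is over. -/
structure SurfaceDiagram (X : Type*) where
  /-- the other half-edge of the same edge -/
  mate : HalfEdge X → HalfEdge X
  mate_mate : ∀ h, mate (mate h) = h
  /-- outgoing half-edges (`2`, `3`) are glued to incoming ones (`0`, `1`) and vice versa -/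
  mate_oriented : ∀ h, 2 ≤ (mate h).2 ↔ h.2 < 2
  /-- the strand that is over at a crossing -/
  overStrand : X → Strand

namespace SurfaceDiagram

variable {X : Type*} (D : SurfaceDiagram X)

/-- A crossing is positive when a counterclockwise turn by less than a half-turn takes the direction
of the over strand to the direction of the under strand. The strand from `0` to `2` turns
counterclockwise to the strand from `1` to `3`. -/
def positive (x : X) : Bool := decide (D.overStrand x = Strand.zeroTwo)

/-- The next corner along the boundary of a face (kept on the left): the corner `(x, i)` lies on
the left of the half-edge `(x, i)` traversed away from `x`; if this edge ends with the half-edge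
`(y, j)`, then the next corner of the face is the one just before `(y, j)`. -/
def nextCorner (c : HalfEdge X) : HalfEdge X := ((D.mate c).1, (D.mate c).2 - 1)

/-- The faces: the orbits of corners under `nextCorner`. -/
def Face : Type _ := Quot fun c c' : HalfEdge X => c' = D.nextCorner c

/-- The face that contains a corner. -/
def face (c : HalfEdge X) : D.Face := Quot.mk _ c

instance [Finite X] : Finite D.Face := by unfold Face; infer_instance

instance [Finite X] : Fintype D.Face := Fintype.ofFinite _

/-- Two faces share an edge. The face on the left of the half-edge `h`, traversed away from its
crossing, is `face h`, and the face on its right is `face (mate h)`. -/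
def ShareEdge (F G : D.Face) : Prop := ∃ h : HalfEdge X, F = D.face h ∧ G = D.face (D.mate h)

/-- A state: a colouring of the faces (`true` is black, i.e. `1`; `false` is white, i.e. `0`)
such that two faces that share an edge are not both black. -/
def State : Type _ :=
  {σ : D.Face → Bool // ∀ F G, D.ShareEdge F G → ¬ (σ F = true ∧ σ G = true)}

instance [Finite X] : Finite D.State := by unfold State; infer_instance

instance [Finite X] : Fintype D.State := Fintype.ofFinite _

end SurfaceDiagram

/-- An oriented link diagram in the plane (equivalently, on the sphere) that is connected and has
at least one crossing. Planarity of the connected map is expressed by Euler's formula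
`V - E + F = 2`, where `E = 2 V` as the map is 4-valent. -/
structure LinkDiagram (X : Type*) [Fintype X] extends SurfaceDiagram X where
  exists_crossing : Nonempty X
  connected : ∀ x y : X,
    Relation.ReflTransGen (fun a b => ∃ i j : Fin 4, mate (a, i) = (b, j)) x y
  planar : (Fintype.card X : ℤ) - 2 * Fintype.card X + Fintype.card toSurfaceDiagram.Face = 2

/-- The decimal value of the bit sequence `b 0, b 1, b 2, b 3`. -/
def decimal (b : Fin 4 → Bool) : ℕ :=
  8 * (b 0).toNat + 4 * (b 1).toNat + 2 * (b 2).toNat + (b 3).toNat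

/-- The decimal values of the four-bit sequences without two cyclically consecutive ones. -/
def codes : Finset ℕ := {0, 1, 2, 4, 5, 8, 10}

theorem decimal_mem_codes :
    ∀ b : Fin 4 → Bool, (∀ i, ¬ (b (i + 1) = true ∧ b i = true)) → decimal b ∈ codes := by
  decide

/-- The 16 variables. -/
inductive StateVar
  /-- the variable of a face: `f₀` if it is white, `f₁` if it is black -/
  | face (black : Bool)
  /-- the variable of a crossing: `Xₙ` if it is positive, `xₙ` if it is negative -/
  | crossing (positive : Bool) (n : codes)

/-- The variable `f₀`. -/
def f₀ : StateVar := .face false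

/-- The variable `f₁`. -/
def f₁ : StateVar := .face true

/-- The variable `Xₙ` (if `pos`) or `xₙ` (if not), where `n ∈ {0, 1, 2, 4, 5, 8, 10}`. -/
def cv (pos : Bool) (n : ℕ) (h : n ∈ codes := by decide) : StateVar := .crossing pos ⟨n, h⟩

namespace SurfaceDiagram

variable {X : Type*} (D : SurfaceDiagram X)

theorem face_nextCorner (c : HalfEdge X) : D.face (D.nextCorner c) = D.face c :=
  (Quot.sound (r := fun c c' : HalfEdge X => c' = D.nextCorner c) rfl).symm

theorem shareEdge_corner (x : X) (i : Fin 4) :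
    D.ShareEdge (D.face (x, i + 1)) (D.face (x, i)) := by
  refine ⟨(x, i + 1), rfl, ?_⟩
  rw [← D.face_nextCorner (D.mate (x, i + 1))]
  simp [nextCorner, D.mate_mate]

/-- The bits of the four corners of a crossing, counterclockwise from the distinguished angle. -/
def bits (σ : D.State) (x : X) : Fin 4 → Bool := fun i => σ.1 (D.face (x, i))

/-- The variable that a state induces at a crossing. -/
def crossingVar (σ : D.State) (x : X) : StateVar :=
  .crossing (D.positive x) ⟨decimal (D.bits σ x),
    decimal_mem_codes _ fun i => σ.2 _ _ (D.shareEdge_corner x i)⟩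

/-- The monomial of a state: the product of the variables at the crossings and at the faces. -/
def monomial [Fintype X] (σ : D.State) : MvPolynomial StateVar ℤ :=
  (∏ x : X, MvPolynomial.X (D.crossingVar σ x)) *
    ∏ F : D.Face, MvPolynomial.X (StateVar.face (σ.1 F))

/-- The state sum. -/
def stateSum [Fintype X] : MvPolynomial StateVar ℤ := ∑ σ : D.State, D.monomial σ

/-- The evaluation of a diagram: the state sum, with the variables specialized to elements of a
commutative ring. -/
def eval [Fintype X] {A : Type*} [CommRing A] (v : StateVar → A) : A :=
  MvPolynomial.aeval v D.stateSum

end SurfaceDiagram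

/-- The sense in which the loop of a curl is traversed. -/
inductive Rotation
  | clockwise
  | counterclockwise

/-- The diagram `D` results from the diagram `D'` by removing a curl, i.e. by a Reidemeister move
of type 1. The sign of the crossing of the curl and the sense of its loop give the four types. -/
structure CurlRemoval {X Y : Type*} [Fintype X] [Fintype Y]
    (D' : LinkDiagram X) (D : LinkDiagram Y) where
  /-- the crossing of the curl -/
  crossing : X
  /-- the sense of its loop -/
  rotation : Rotation
  /-- The loop is an edge that bounds a face with one corner. If it is traversed clockwise, it
  leaves by `2`, returns by `1` and bounds corner `1`; if it is traversed counterclockwise, it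
  leaves by `3`, returns by `0` and bounds corner `3`. -/
  loop : match rotation with
    | .clockwise => D'.mate (crossing, 2) = (crossing, 1)
    | .counterclockwise => D'.mate (crossing, 3) = (crossing, 0)
  /-- the crossings of `D` are the other crossings of `D'` -/
  incl : Y → X
  incl_injective : Function.Injective incl
  range_incl : ∀ x : X, x ∈ Set.range incl ↔ x ≠ crossing
  overStrand_incl : ∀ y, D'.overStrand (incl y) = D.overStrand y
  /-- the edges of `D'` that avoid the crossing of the curl are edges of `D` -/
  mate_of_avoid : ∀ h : HalfEdge Y, (D'.mate (incl h.1, h.2)).1 ≠ crossing →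
    D'.mate (incl h.1, h.2) = (incl (D.mate h).1, (D.mate h).2)
  /-- The two other edges at the crossing of the curl are joined to form one edge of `D`. Their
  half-edges at this crossing are `0, 3` (clockwise loop) or `1, 2` (counterclockwise loop), so
  that they are exchanged by `Fin.rev`, i.e. by `j ↦ 3 - j`. -/
  mate_of_meet : ∀ (h : HalfEdge Y) (j : Fin 4), D'.mate (incl h.1, h.2) = (crossing, j) →
    D'.mate (crossing, j.rev) = (incl (D.mate h).1, (D.mate h).2)

/-- The identities `f₀ x₀ + f₁ x₄ = f₀ x₁₀ = f₀ x₁ + f₁ x₅` and the analogous ones for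
`X₀, X₁, X₄, X₅, X₁₀`. -/
def CurlIdentities {A : Type*} [CommRing A] (v : StateVar → A) : Prop :=
  ∀ ε : Bool,
    v f₀ * v (cv ε 0) + v f₁ * v (cv ε 4) = v f₀ * v (cv ε 10) ∧
    v f₀ * v (cv ε 10) = v f₀ * v (cv ε 1) + v f₁ * v (cv ε 5)

/-- The polynomial ring `ℤ[s, S]`, with `s = X 0` and `S = X 1`. -/
abbrev PolyRing := MvPolynomial (Fin 2) ℤ

/-- The ideal generated by `p₁`, `p₂`, `p₃`. -/
def idealI : Ideal PolyRing :=
  let s : PolyRing := MvPolynomial.X 0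
  let S : PolyRing := MvPolynomial.X 1
  Ideal.span {1 + s + s ^ 2 + s ^ 3 + s ^ 4,
    1 + S + S ^ 2 + S ^ 3 + S ^ 4,
    s ^ 4 + s ^ 3 * S + s ^ 2 * S ^ 2 + s * S ^ 3 + S ^ 4}

/-- The quotient ring `ℤ[s, S] / I`. -/
abbrev QuotRing := PolyRing ⧸ idealI

/-- The class of `s`. -/
def sHat : QuotRing := Ideal.Quotient.mk idealI (MvPolynomial.X 0)

/-- The class of `S`. -/
def SHat : QuotRing := Ideal.Quotient.mk idealI (MvPolynomial.X 1)

/-- The assignment of the 16 variables in terms of two elements `s`, `S` of a commutative ring. -/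
def assignment {A : Type*} [CommRing A] (s S : A) : StateVar → A
  | .face false => s ^ 2 * S ^ 2
  | .face true => s ^ 4 + S ^ 4
  | .crossing false ⟨n, _⟩ =>
    if n = 0 then s + S
    else if n = 1 then S
    else if n = 2 then s
    else if n = 4 then S
    else if n = 5 then -(s ^ 2 * S ^ 4)
    else if n = 8 then s
    else -(s ^ 4 * S ^ 2)
  | .crossing true ⟨n, _⟩ =>
    if n = 0 then s + S
    else if n = 1 then s
    else if n = 2 then S
    else if n = 4 then s
    else if n = 5 then -(s ^ 4 * S ^ 2)
    else if n = 8 then S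
    else -(s ^ 2 * S ^ 4)

end

end FacialState

/-!
Extend the crossing variables by zero to all patterns of four bits. Since a colouring of the faces
that is not a state has two consecutive black corners at some crossing, its weight then vanishes,
and the state sum becomes a sum over all colourings.

Inserting a curl into an edge `e` creates one new face, the one inside the loop. Two of the other
corners at the new crossing lie in the face on one side of `e`, and the corner opposite to the loop
lies in the face on the other side. Summing over the colour of the loop face therefore multiplies
the weight of a colouring of the old faces by a factor that depends only on the colours of the two
sides of `e`, and `CurlIdentities` says that this factor is `f₀ X₁₀` (or `f₀ x₁₀`) unless both sides
are black, in which case the weight is zero anyway.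
-/

namespace FacialState

noncomputable section

section CrossingWeight

variable {A : Type*}

theorem decimal_mem_codes_iff : ∀ b : Fin 4 → Bool,
    decimal b ∈ codes ↔ ∀ i, ¬(b (i + 1) = true ∧ b i = true) := by
  decide

/-- The value of the variable of a crossing of sign `ε` whose corners carry the bits `b`, extended
by zero to the bit sequences with two cyclically consecutive ones. -/
def crossingWeight [Zero A] (v : StateVar → A) (ε : Bool) (b : Fin 4 → Bool) : A :=
  if h : decimal b ∈ codes then v (.crossing ε ⟨decimal b, h⟩) else 0

theorem crossingWeight_eq_zero [Zero A] (v : StateVar → A) (ε : Bool) {b : Fin 4 → Bool}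
    {i : Fin 4} (hsucc : b (i + 1) = true) (hi : b i = true) : crossingWeight v ε b = 0 :=
  dif_neg fun h => (decimal_mem_codes_iff b).1 h i ⟨hsucc, hi⟩

theorem crossingWeight_of_decimal_eq [Zero A] (v : StateVar → A) (ε : Bool) {b : Fin 4 → Bool}
    (n : ℕ) (hb : decimal b = n) (hn : n ∈ codes := by decide) :
    crossingWeight v ε b = v (cv ε n hn) := by
  subst hb
  exact dif_pos hn

/-- The number of the corner inside the loop of a curl. -/
def Rotation.loopCorner : Rotation → Fin 4
  | .clockwise => 1
  | .counterclockwise => 3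

/-- The bits at the crossing of a curl whose loop is at corner `k`, where `loop` is the bit of the
face in the loop, `outer` the one of the face around the loop, which has two corners at the
crossing, and `opposite` the one of the face opposite to the loop. -/
def curlBits (k : Fin 4) (loop outer opposite : Bool) : Fin 4 → Bool :=
  fun i => ![loop, outer, opposite, outer] (i - k)

theorem CurlIdentities.sum_crossingWeight_curlBits [CommRing A] {v : StateVar → A}
    (hv : CurlIdentities v) {ρ : Rotation} {ε : Bool}
    (hρ : ρ = .clockwise ∨ v (cv ε 1) = v (cv ε 4)) {outer opposite : Bool}
    (hwhite : ¬(outer = true ∧ opposite = true)) :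
    ∑ loop, crossingWeight v ε (curlBits ρ.loopCorner loop outer opposite) * v (.face loop) =
      v f₀ * v (cv ε 10) := by
  obtain ⟨h0, h1⟩ := hv ε
  rw [Fintype.sum_bool]
  change _ * v f₁ + _ * v f₀ = _
  cases ρ <;> cases outer <;> cases opposite
  · rw [crossingWeight_of_decimal_eq v ε 4 rfl, crossingWeight_of_decimal_eq v ε 0 rfl]
    linear_combination h0
  · rw [crossingWeight_of_decimal_eq v ε 5 rfl, crossingWeight_of_decimal_eq v ε 1 rfl]
    linear_combination -h1
  · rw [crossingWeight_eq_zero v ε (i := 0) rfl rfl, crossingWeight_of_decimal_eq v ε 10 rfl]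
    ring
  · simp at hwhite
  all_goals have h14 : v (cv ε 1) = v (cv ε 4) := by simpa using hρ
  · rw [crossingWeight_of_decimal_eq v ε 1 rfl, crossingWeight_of_decimal_eq v ε 0 rfl]
    linear_combination h0 + v f₁ * h14
  · rw [crossingWeight_of_decimal_eq v ε 5 rfl, crossingWeight_of_decimal_eq v ε 4 rfl]
    linear_combination -h1 - v f₀ * h14
  · rw [crossingWeight_eq_zero v ε (i := 3) rfl rfl, crossingWeight_of_decimal_eq v ε 10 rfl]
    ring
  · simp at hwhite

end CrossingWeight

namespace SurfaceDiagram

variable {X : Type*} (D : SurfaceDiagram X)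

theorem face_mate (h : HalfEdge X) : D.face (D.mate h) = D.face (h.1, h.2 - 1) := by
  rw [← D.face_nextCorner (D.mate h), nextCorner, D.mate_mate]

/-- A map on corners that is constant along the boundaries of faces, as a map on faces. -/
def liftFace {α : Type*} (f : HalfEdge X → α) (hf : ∀ h, f (D.mate h) = f (h.1, h.2 - 1)) :
    D.Face → α :=
  Quot.lift f fun h h' e => by rw [e, nextCorner, ← hf, D.mate_mate]

@[simp]
theorem liftFace_face {α : Type*} (f : HalfEdge X → α)
    (hf : ∀ h, f (D.mate h) = f (h.1, h.2 - 1)) (h : HalfEdge X) :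
    D.liftFace f hf (D.face h) = f h :=
  rfl

theorem face_surjective : Function.Surjective D.face :=
  Quot.exists_rep

variable [Fintype X] {A : Type*}

/-- The weight of an arbitrary colouring of the faces; it is the value of the monomial of a state
if the colouring is a state. -/
def weight [CommMonoidWithZero A] (v : StateVar → A) (σ : D.Face → Bool) : A :=
  (∏ x : X, crossingWeight v (D.positive x) fun i => σ (D.face (x, i))) *
    ∏ F : D.Face, v (.face (σ F))

theorem weight_eq_zero_of_shareEdge [CommMonoidWithZero A] (v : StateVar → A)
    {σ : D.Face → Bool} {F G : D.Face} (hFG : D.ShareEdge F G) (hF : σ F = true)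
    (hG : σ G = true) : D.weight v σ = 0 := by
  obtain ⟨⟨x, i⟩, rfl, rfl⟩ := hFG
  rw [D.face_mate] at hG
  have hx : crossingWeight v (D.positive x) (fun i => σ (D.face (x, i))) = 0 :=
    crossingWeight_eq_zero v _ (i := i - 1) (by simpa using hF) hG
  exact mul_eq_zero_of_left (Finset.prod_eq_zero (Finset.mem_univ x) hx) _

theorem aeval_monomial [CommRing A] (v : StateVar → A) (σ : D.State) :
    MvPolynomial.aeval v (D.monomial σ) = D.weight v σ.1 := by
  have crossing (x : X) : crossingWeight v (D.positive x) (D.bits σ x) = v (D.crossingVar σ x) :=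
    crossingWeight_of_decimal_eq v _ _ rfl _
  simp only [monomial, weight, map_mul, map_prod, MvPolynomial.aeval_X, ← crossing]
  rfl

theorem eval_eq_sum_weight [DecidableEq D.Face] [CommRing A] (v : StateVar → A) :
    D.eval v = ∑ σ : D.Face → Bool, D.weight v σ := by
  classical
  let IsState (σ : D.Face → Bool) : Prop :=
    ∀ F G, D.ShareEdge F G → ¬(σ F = true ∧ σ G = true)
  have isState_of_weight_ne (σ : D.Face → Bool) (hσ : D.weight v σ ≠ 0) : IsState σ :=
    fun _ _ hFG ⟨hF, hG⟩ => hσ (D.weight_eq_zero_of_shareEdge v hFG hF hG)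
  calc
    D.eval v = ∑ σ : D.State, D.weight v σ.1 := by
      simp only [eval, stateSum, map_sum, aeval_monomial]
    _ = ∑ σ with IsState σ, D.weight v σ :=
      (Finset.sum_subtype _ (fun σ => Finset.mem_filter_univ σ) _).symm
    _ = ∑ σ, D.weight v σ := Finset.sum_filter_of_ne fun σ _ => isState_of_weight_ne σ

end SurfaceDiagram

/-- The surface diagram `D'` results from `D` by inserting a curl into an edge. Unlike in
`CurlRemoval`, the edge is part of the data. -/
structure CurlInsertion {X Y : Type*} (D' : SurfaceDiagram X) (D : SurfaceDiagram Y) where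
  /-- the crossing of the curl -/
  crossing : X
  /-- the sense of its loop -/
  rotation : Rotation
  /-- the crossings of `D`, as crossings of `D'` -/
  incl : Y → X
  bijective : Function.Bijective fun o : Option Y => o.elim crossing incl
  overStrand_incl : ∀ y, D'.overStrand (incl y) = D.overStrand y
  /-- the half-edge of the divided edge that has the face opposite to the loop on its left -/
  edge : HalfEdge Y
  mate_loop : D'.mate (crossing, rotation.loopCorner) = (crossing, rotation.loopCorner + 1)
  mate_edge : D'.mate (incl edge.1, edge.2) = (crossing, rotation.loopCorner + 3)
  mate_mate_edge : D'.mate (incl (D.mate edge).1, (D.mate edge).2) =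
    (crossing, rotation.loopCorner + 2)
  mate_of_ne : ∀ h, h ≠ edge → h ≠ D.mate edge →
    D'.mate (incl h.1, h.2) = (incl (D.mate h).1, (D.mate h).2)

namespace CurlInsertion

variable {X Y : Type*} {D' : SurfaceDiagram X} {D : SurfaceDiagram Y} (r : CurlInsertion D' D)

/-- The crossings of `D'` are the crossing of the curl and the crossings of `D`. -/
def crossingEquiv : Option Y ≃ X :=
  Equiv.ofBijective _ r.bijective

@[simp]
theorem crossingEquiv_symm_crossing : r.crossingEquiv.symm r.crossing = none :=
  r.crossingEquiv.symm_apply_apply none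

@[simp]
theorem crossingEquiv_symm_incl (y : Y) : r.crossingEquiv.symm (r.incl y) = some y :=
  r.crossingEquiv.symm_apply_apply (some y)

/-- A half-edge or corner of `D`, as one of `D'`. -/
def inclHalfEdge (h : HalfEdge Y) : HalfEdge X :=
  (r.incl h.1, h.2)

/-- The half-edge or corner of `D'` at the crossing of the curl whose number is `i` if one counts
from the loop. -/
def curlHalfEdge (i : Fin 4) : HalfEdge X :=
  (r.crossing, r.rotation.loopCorner + i)

@[elab_as_elim]
theorem halfEdge_induction {motive : HalfEdge X → Prop}
    (curl : ∀ i, motive (r.curlHalfEdge i)) (incl : ∀ h, motive (r.inclHalfEdge h))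
    (h : HalfEdge X) : motive h := by
  obtain ⟨x, j⟩ := h
  obtain ⟨_ | y, rfl⟩ := r.bijective.2 x
  · simpa [curlHalfEdge] using curl (j - r.rotation.loopCorner)
  · exact incl (y, j)

theorem mate_curlHalfEdge_zero : D'.mate (r.curlHalfEdge 0) = r.curlHalfEdge 1 := by
  simpa [curlHalfEdge] using r.mate_loop

theorem mate_curlHalfEdge_one : D'.mate (r.curlHalfEdge 1) = r.curlHalfEdge 0 := by
  rw [← r.mate_curlHalfEdge_zero, D'.mate_mate]

theorem mate_inclHalfEdge_edge : D'.mate (r.inclHalfEdge r.edge) = r.curlHalfEdge 3 :=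
  r.mate_edge

theorem mate_inclHalfEdge_mate_edge :
    D'.mate (r.inclHalfEdge (D.mate r.edge)) = r.curlHalfEdge 2 :=
  r.mate_mate_edge

theorem mate_curlHalfEdge_two :
    D'.mate (r.curlHalfEdge 2) = r.inclHalfEdge (D.mate r.edge) := by
  rw [← r.mate_inclHalfEdge_mate_edge, D'.mate_mate]

theorem mate_curlHalfEdge_three : D'.mate (r.curlHalfEdge 3) = r.inclHalfEdge r.edge := by
  rw [← r.mate_inclHalfEdge_edge, D'.mate_mate]

theorem eq_edge_or_eq_mate_edge_or_mate_inclHalfEdge (h : HalfEdge Y) :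
    h = r.edge ∨ h = D.mate r.edge ∨ D'.mate (r.inclHalfEdge h) = r.inclHalfEdge (D.mate h) := by
  by_cases hedge : h = r.edge
  · exact .inl hedge
  by_cases hmate : h = D.mate r.edge
  · exact .inr (.inl hmate)
  exact .inr (.inr (r.mate_of_ne h hedge hmate))

theorem face_mate_curlHalfEdge (i : Fin 4) :
    D'.face (D'.mate (r.curlHalfEdge i)) = D'.face (r.curlHalfEdge (i - 1)) := by
  rw [D'.face_mate]
  simp only [curlHalfEdge, add_sub_assoc]

theorem face_curlHalfEdge_one :
    D'.face (r.curlHalfEdge 1) = D'.face (r.inclHalfEdge (D.mate r.edge)) := by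
  rw [← r.mate_curlHalfEdge_two, r.face_mate_curlHalfEdge]
  rfl

theorem face_curlHalfEdge_two :
    D'.face (r.curlHalfEdge 2) = D'.face (r.inclHalfEdge r.edge) := by
  rw [← r.mate_curlHalfEdge_three, r.face_mate_curlHalfEdge]
  rfl

theorem face_curlHalfEdge_three :
    D'.face (r.curlHalfEdge 3) = D'.face (r.inclHalfEdge (D.mate r.edge)) := by
  rw [← r.face_curlHalfEdge_one, ← r.mate_curlHalfEdge_zero, r.face_mate_curlHalfEdge]
  rfl

theorem face_inclHalfEdge_mate (h : HalfEdge Y) :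
    D'.face (r.inclHalfEdge (D.mate h)) = D'.face (r.inclHalfEdge (h.1, h.2 - 1)) := by
  change _ = D'.face ((r.inclHalfEdge h).1, (r.inclHalfEdge h).2 - 1)
  rw [← D'.face_mate]
  rcases r.eq_edge_or_eq_mate_edge_or_mate_inclHalfEdge h with rfl | rfl | hmate
  · rw [r.mate_inclHalfEdge_edge, r.face_curlHalfEdge_three]
  · rw [r.mate_inclHalfEdge_mate_edge, r.face_curlHalfEdge_two, D.mate_mate]
  · rw [hmate]

/-- The face of `D'` that results from a face of `D`. -/
def inclFace : D.Face → D'.Face :=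
  D.liftFace (fun h => D'.face (r.inclHalfEdge h)) r.face_inclHalfEdge_mate

/-- The face of `D` from which the face of a corner of `D'` results; it is `none` for the corner
inside the loop. -/
def cornerFace (h : HalfEdge X) : Option D.Face :=
  match r.crossingEquiv.symm h.1 with
  | some y => some (D.face (y, h.2))
  | none => ![none, some (D.face (D.mate r.edge)), some (D.face r.edge),
      some (D.face (D.mate r.edge))] (h.2 - r.rotation.loopCorner)

theorem cornerFace_inclHalfEdge (h : HalfEdge Y) :
    r.cornerFace (r.inclHalfEdge h) = some (D.face h) := by
  simp only [cornerFace, inclHalfEdge, crossingEquiv_symm_incl]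

theorem cornerFace_curlHalfEdge (i : Fin 4) :
    r.cornerFace (r.curlHalfEdge i) = ![none, some (D.face (D.mate r.edge)),
      some (D.face r.edge), some (D.face (D.mate r.edge))] i := by
  simp only [cornerFace, curlHalfEdge, crossingEquiv_symm_crossing, add_sub_cancel_left]

theorem cornerFace_mate (h : HalfEdge X) :
    r.cornerFace (D'.mate h) = r.cornerFace (h.1, h.2 - 1) := by
  induction h using r.halfEdge_induction with
  | curl i =>
    have prev : ((r.curlHalfEdge i).1, (r.curlHalfEdge i).2 - 1) = r.curlHalfEdge (i - 1) := by
      simp only [curlHalfEdge, add_sub_assoc]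
    rw [prev, r.cornerFace_curlHalfEdge]
    match i with
    | 0 => rw [r.mate_curlHalfEdge_zero, r.cornerFace_curlHalfEdge]; rfl
    | 1 => rw [r.mate_curlHalfEdge_one, r.cornerFace_curlHalfEdge]; rfl
    | 2 => rw [r.mate_curlHalfEdge_two, r.cornerFace_inclHalfEdge]; rfl
    | 3 => rw [r.mate_curlHalfEdge_three, r.cornerFace_inclHalfEdge]; rfl
  | incl h =>
    change _ = r.cornerFace (r.inclHalfEdge (h.1, h.2 - 1))
    rw [r.cornerFace_inclHalfEdge, ← D.face_mate]
    rcases r.eq_edge_or_eq_mate_edge_or_mate_inclHalfEdge h with rfl | rfl | hmate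
    · rw [r.mate_inclHalfEdge_edge, r.cornerFace_curlHalfEdge]; rfl
    · rw [r.mate_inclHalfEdge_mate_edge, r.cornerFace_curlHalfEdge, D.mate_mate]; rfl
    · rw [hmate, r.cornerFace_inclHalfEdge]

/-- The faces of `D'` are the face in the loop and the faces of `D`. -/
def faceEquiv : Option D.Face ≃ D'.Face where
  toFun o := o.elim (D'.face (r.curlHalfEdge 0)) r.inclFace
  invFun := D'.liftFace r.cornerFace r.cornerFace_mate
  left_inv := by
    rintro (_ | F)
    · exact r.cornerFace_curlHalfEdge 0
    · obtain ⟨h, rfl⟩ := D.face_surjective F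
      exact r.cornerFace_inclHalfEdge h
  right_inv F := by
    obtain ⟨h, rfl⟩ := D'.face_surjective F
    rw [D'.liftFace_face]
    induction h using r.halfEdge_induction with
    | curl i =>
      rw [r.cornerFace_curlHalfEdge]
      match i with
      | 0 => rfl
      | 1 => exact r.face_curlHalfEdge_one.symm
      | 2 => exact r.face_curlHalfEdge_two.symm
      | 3 => exact r.face_curlHalfEdge_three.symm
    | incl h => rw [r.cornerFace_inclHalfEdge]; rfl

@[simp]
theorem faceEquiv_symm_face (h : HalfEdge X) : r.faceEquiv.symm (D'.face h) = r.cornerFace h :=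
  rfl

/-- A colouring of the faces of `D'` is a colour of the face in the loop together with a colouring
of the faces of `D`. -/
def colouringEquiv : Bool × (D.Face → Bool) ≃ (D'.Face → Bool) :=
  (Equiv.piOptionEquivProd (β := fun _ => Bool)).symm.trans (r.faceEquiv.arrowCongr (.refl Bool))

theorem colouringEquiv_apply (loop : Bool) (σ : D.Face → Bool) (F : D'.Face) :
    r.colouringEquiv (loop, σ) F = (r.faceEquiv.symm F).elim loop σ := by
  change Equiv.piOptionEquivProd (β := fun _ => Bool).symm (loop, σ) (r.faceEquiv.symm F) = _
  cases r.faceEquiv.symm F <;> rfl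

theorem colouringEquiv_face_inclHalfEdge (loop : Bool) (σ : D.Face → Bool) (h : HalfEdge Y) :
    r.colouringEquiv (loop, σ) (D'.face (r.inclHalfEdge h)) = σ (D.face h) := by
  rw [colouringEquiv_apply, faceEquiv_symm_face, cornerFace_inclHalfEdge, Option.elim_some]

theorem colouringEquiv_face_crossing (loop : Bool) (σ : D.Face → Bool) :
    (fun j => r.colouringEquiv (loop, σ) (D'.face (r.crossing, j))) =
      curlBits r.rotation.loopCorner loop (σ (D.face (D.mate r.edge))) (σ (D.face r.edge)) := by
  funext j
  obtain ⟨i, rfl⟩ : ∃ i, j = r.rotation.loopCorner + i := ⟨j - _, (add_sub_cancel _ j).symm⟩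
  rw [curlBits, add_sub_cancel_left, colouringEquiv_apply, faceEquiv_symm_face]
  change (r.cornerFace (r.curlHalfEdge i)).elim loop σ = _
  rw [cornerFace_curlHalfEdge]
  fin_cases i <;> rfl

theorem positive_incl (y : Y) : D'.positive (r.incl y) = D.positive y := by
  rw [SurfaceDiagram.positive, r.overStrand_incl, SurfaceDiagram.positive]

variable [Fintype X] [Fintype Y] {A : Type*}

theorem weight_colouringEquiv [CommMonoidWithZero A] (v : StateVar → A) (loop : Bool)
    (σ : D.Face → Bool) :
    D'.weight v (r.colouringEquiv (loop, σ)) =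
      crossingWeight v (D'.positive r.crossing)
        (curlBits r.rotation.loopCorner loop (σ (D.face (D.mate r.edge))) (σ (D.face r.edge))) *
      v (.face loop) * D.weight v σ := by
  let τ := r.colouringEquiv (loop, σ)
  have crossings : (∏ x, crossingWeight v (D'.positive x) fun j => τ (D'.face (x, j))) =
      crossingWeight v (D'.positive r.crossing)
        (curlBits r.rotation.loopCorner loop (σ (D.face (D.mate r.edge))) (σ (D.face r.edge))) *
      ∏ y, crossingWeight v (D.positive y) fun j => σ (D.face (y, j)) := by
    rw [← r.crossingEquiv.prod_comp, Fintype.prod_option]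
    congr 1
    · exact congrArg _ (r.colouringEquiv_face_crossing loop σ)
    · refine Fintype.prod_congr _ _ fun y => ?_
      change crossingWeight v (D'.positive (r.incl y)) _ = _
      rw [r.positive_incl]
      exact congrArg _ (funext fun j => r.colouringEquiv_face_inclHalfEdge loop σ (y, j))
  have faces : ∏ F, v (.face (τ F)) = v (.face loop) * ∏ F, v (.face (σ F)) := by
    simp only [τ, ← r.faceEquiv.prod_comp, Fintype.prod_option, colouringEquiv_apply,
      Equiv.symm_apply_apply, Option.elim_none, Option.elim_some]
  rw [SurfaceDiagram.weight, crossings, faces, SurfaceDiagram.weight, mul_mul_mul_comm]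

theorem eval_eq [CommRing A] {v : StateVar → A} (hv : CurlIdentities v)
    (hr : r.rotation = .clockwise ∨ ∀ ε, v (cv ε 1) = v (cv ε 4)) :
    D'.eval v = v f₀ * v (cv (D'.positive r.crossing) 10) * D.eval v := by
  classical
  rw [D'.eval_eq_sum_weight, D.eval_eq_sum_weight, ← r.colouringEquiv.sum_comp,
    Fintype.sum_prod_type_right, Finset.mul_sum]
  refine Fintype.sum_congr _ _ fun σ => ?_
  simp only [weight_colouringEquiv, ← Finset.sum_mul]
  by_cases hblack : σ (D.face (D.mate r.edge)) = true ∧ σ (D.face r.edge) = true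
  · rw [D.weight_eq_zero_of_shareEdge v ⟨r.edge, rfl, rfl⟩ hblack.2 hblack.1, mul_zero, mul_zero]
  · rw [hv.sum_crossingWeight_curlBits (hr.imp_right fun h => h _) hblack]

end CurlInsertion

theorem exists_exit_of_reflTransGen {α : Type*} {rel : α → α → Prop} {p : α → Prop} {a b : α}
    (hab : Relation.ReflTransGen rel a b) (ha : p a) (hb : ¬p b) :
    ∃ c d, p c ∧ ¬p d ∧ rel c d := by
  induction hab with
  | refl => exact absurd ha hb
  | @tail c d _ hcd ih =>
    by_cases hc : p c
    · exact ⟨c, d, hc, hb, hcd⟩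
    · exact ih hc

theorem Rotation.rev_loopCorner_add_two (ρ : Rotation) :
    (ρ.loopCorner + 2).rev = ρ.loopCorner + 3 := by
  cases ρ <;> rfl

theorem Rotation.rev_loopCorner_add_three (ρ : Rotation) :
    (ρ.loopCorner + 3).rev = ρ.loopCorner + 2 := by
  cases ρ <;> rfl

namespace CurlRemoval

variable {X Y : Type*} [Fintype X] [Fintype Y] {D' : LinkDiagram X} {D : LinkDiagram Y}
  (r : CurlRemoval D' D)

theorem incl_ne_crossing (y : Y) : r.incl y ≠ r.crossing :=
  (r.range_incl _).1 ⟨y, rfl⟩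

theorem bijective_elim : Function.Bijective fun o : Option Y => o.elim r.crossing r.incl := by
  constructor
  · rintro (_ | y) (_ | z) h
    · rfl
    · exact absurd h.symm (r.incl_ne_crossing z)
    · exact absurd h (r.incl_ne_crossing y)
    · exact congrArg some (r.incl_injective h)
  · intro x
    by_cases hx : x = r.crossing
    · exact ⟨none, hx.symm⟩
    · obtain ⟨y, rfl⟩ := (r.range_incl x).2 hx
      exact ⟨some y, rfl⟩

theorem mate_loopCorner : D'.mate (r.crossing, r.rotation.loopCorner) =
    (r.crossing, r.rotation.loopCorner + 1) := by
  obtain ⟨c, ρ, hloop⟩ := r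
  cases ρ
  · exact (congrArg D'.mate hloop.symm).trans (D'.mate_mate _)
  · exact hloop

theorem inclHalfEdge_injective :
    Function.Injective fun h : HalfEdge Y => (r.incl h.1, h.2) :=
  r.incl_injective.prodMap Function.injective_id

theorem eq_loopCorner_add_of_mate_incl {h : HalfEdge Y} {j : Fin 4}
    (hj : D'.mate (r.incl h.1, h.2) = (r.crossing, j)) :
    j = r.rotation.loopCorner + 2 ∨ j = r.rotation.loopCorner + 3 := by
  have ne_loop {i : Fin 4} (hi : D'.mate (r.crossing, j) = (r.crossing, i)) : False := by
    rw [← hj, D'.mate_mate] at hi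
    exact r.incl_ne_crossing _ (congrArg Prod.fst hi)
  obtain ⟨i, rfl⟩ : ∃ i, j = r.rotation.loopCorner + i := ⟨j - _, (add_sub_cancel _ j).symm⟩
  match i with
  | 0 => exact (ne_loop (by rw [add_zero, r.mate_loopCorner])).elim
  | 1 => exact (ne_loop (by conv_lhs => rw [← r.mate_loopCorner, D'.mate_mate])).elim
  | 2 => exact .inl rfl
  | 3 => exact .inr rfl

theorem exists_mate_incl_eq_crossing :
    ∃ (h : HalfEdge Y) (j : Fin 4), D'.mate (r.incl h.1, h.2) = (r.crossing, j) := by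
  obtain ⟨y⟩ := D.exists_crossing
  obtain ⟨_, x, rfl, hx, j, i, hij⟩ := exists_exit_of_reflTransGen (p := (· = r.crossing))
    (D'.connected r.crossing (r.incl y)) rfl (r.incl_ne_crossing y)
  obtain ⟨z, rfl⟩ := (r.range_incl x).2 hx
  exact ⟨(z, i), j, by rw [← hij, D'.mate_mate]⟩

theorem exists_mate_incl_eq_loopCorner_add_three : ∃ h : HalfEdge Y,
    D'.mate (r.incl h.1, h.2) = (r.crossing, r.rotation.loopCorner + 3) := by
  obtain ⟨h, j, hj⟩ := r.exists_mate_incl_eq_crossing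
  rcases r.eq_loopCorner_add_of_mate_incl hj with rfl | rfl
  · have hmate := r.mate_of_meet h _ hj
    rw [Rotation.rev_loopCorner_add_two] at hmate
    exact ⟨D.mate h, by rw [← hmate, D'.mate_mate]⟩
  · exact ⟨h, hj⟩

/-- The half-edge of `D` that is glued, in `D'`, to the half-edge of the curl that precedes the loop
in counterclockwise order. It exists because `D'` is connected and has another crossing. -/
def edge : HalfEdge Y :=
  r.exists_mate_incl_eq_loopCorner_add_three.choose

theorem mate_incl_edge :
    D'.mate (r.incl r.edge.1, r.edge.2) = (r.crossing, r.rotation.loopCorner + 3) :=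
  r.exists_mate_incl_eq_loopCorner_add_three.choose_spec

theorem mate_incl_mate_edge : D'.mate (r.incl (D.mate r.edge).1, (D.mate r.edge).2) =
    (r.crossing, r.rotation.loopCorner + 2) := by
  rw [← r.mate_of_meet _ _ r.mate_incl_edge, D'.mate_mate, Rotation.rev_loopCorner_add_three]

theorem mate_incl_of_ne {h : HalfEdge Y} (hedge : h ≠ r.edge) (hmate : h ≠ D.mate r.edge) :
    D'.mate (r.incl h.1, h.2) = (r.incl (D.mate h).1, (D.mate h).2) := by
  have injective : Function.Injective fun e : HalfEdge Y => D'.mate (r.incl e.1, e.2) :=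
    (Function.Involutive.injective D'.mate_mate).comp r.inclHalfEdge_injective
  refine r.mate_of_avoid h fun hcrossing => ?_
  have hj : D'.mate (r.incl h.1, h.2) = (r.crossing, (D'.mate (r.incl h.1, h.2)).2) :=
    Prod.ext hcrossing rfl
  rcases r.eq_loopCorner_add_of_mate_incl hj with htwo | hthree
  · rw [htwo, ← r.mate_incl_mate_edge] at hj
    exact hmate (injective hj)
  · rw [hthree, ← r.mate_incl_edge] at hj
    exact hedge (injective hj)

/-- A curl removal, read backwards. -/
def toCurlInsertion : CurlInsertion D'.toSurfaceDiagram D.toSurfaceDiagram where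
  crossing := r.crossing
  rotation := r.rotation
  incl := r.incl
  bijective := r.bijective_elim
  overStrand_incl := r.overStrand_incl
  edge := r.edge
  mate_loop := r.mate_loopCorner
  mate_edge := r.mate_incl_edge
  mate_mate_edge := r.mate_incl_mate_edge
  mate_of_ne _ := r.mate_incl_of_ne

end CurlRemoval

section Assignment

variable {A : Type*} [CommRing A]

theorem pow_five_eq_pow_five {s S : A}
    (h : s ^ 4 + s ^ 3 * S + s ^ 2 * S ^ 2 + s * S ^ 3 + S ^ 4 = 0) : S ^ 5 = s ^ 5 := by
  linear_combination (S - s) * h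

theorem curlIdentities_assignment {s S : A} (hs : s ^ 5 = 1)
    (h : s ^ 4 + s ^ 3 * S + s ^ 2 * S ^ 2 + s * S ^ 3 + S ^ 4 = 0) :
    CurlIdentities (assignment s S) := by
  have hS : S ^ 5 = 1 := (pow_five_eq_pow_five h).trans hs
  rintro (_ | _)
  · change s ^ 2 * S ^ 2 * (s + S) + (s ^ 4 + S ^ 4) * S = s ^ 2 * S ^ 2 * -(s ^ 4 * S ^ 2) ∧
      s ^ 2 * S ^ 2 * -(s ^ 4 * S ^ 2) = s ^ 2 * S ^ 2 * S + (s ^ 4 + S ^ 4) * -(s ^ 2 * S ^ 4)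
    constructor
    · linear_combination S * h + s * S ^ 4 * hs
    · linear_combination s ^ 2 * S ^ 3 * hS
  · change s ^ 2 * S ^ 2 * (s + S) + (s ^ 4 + S ^ 4) * s = s ^ 2 * S ^ 2 * -(s ^ 2 * S ^ 4) ∧
      s ^ 2 * S ^ 2 * -(s ^ 2 * S ^ 4) = s ^ 2 * S ^ 2 * s + (s ^ 4 + S ^ 4) * -(s ^ 4 * S ^ 2)
    constructor
    · linear_combination s * h + s ^ 4 * S * hS
    · linear_combination s ^ 3 * S ^ 2 * hs

theorem assignment_f₀_mul_cv_ten {s S : A} (hs : s ^ 5 = 1) (hS : S ^ 5 = 1) (ε : Bool) :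
    assignment s S f₀ * assignment s S (cv ε 10) =
      if ε = true then -(s ^ 4 * S) else -(s * S ^ 4) := by
  cases ε
  · change s ^ 2 * S ^ 2 * -(s ^ 4 * S ^ 2) = -(s * S ^ 4)
    linear_combination -s * S ^ 4 * hs
  · change s ^ 2 * S ^ 2 * -(s ^ 2 * S ^ 4) = -(s ^ 4 * S)
    linear_combination -s ^ 4 * S * hS

theorem assignment_cv_one (s S : A) (ε : Bool) :
    assignment s S (cv ε 1) = assignment s S (cv ε 4) := by
  cases ε <;> rfl

theorem sHat_pow_five : sHat ^ 5 = 1 := by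
  have hs : 1 + sHat + sHat ^ 2 + sHat ^ 3 + sHat ^ 4 = 0 :=
    Ideal.Quotient.eq_zero_iff_mem.2 <| Ideal.subset_span (.inl rfl)
  linear_combination (sHat - 1) * hs

theorem sHat_SHat_homogeneous :
    sHat ^ 4 + sHat ^ 3 * SHat + sHat ^ 2 * SHat ^ 2 + sHat * SHat ^ 3 + SHat ^ 4 = 0 :=
  Ideal.Quotient.eq_zero_iff_mem.2 <| Ideal.subset_span (.inr (.inr rfl))

end Assignment

end

end FacialState

theorem mainTheorem7_general.{u, v, w} (A : Type u) [CommRing A] :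
    (∀ v : FacialState.StateVar → A, FacialState.CurlIdentities v →
      ∀ (X : Type v) (Y : Type w) [Fintype X] [Fintype Y]
        (D' : FacialState.SurfaceDiagram X) (D : FacialState.SurfaceDiagram Y)
        (r : FacialState.CurlInsertion D' D),
        (r.rotation = FacialState.Rotation.clockwise ∨
          ∀ ε : Bool, v (FacialState.cv ε 1) = v (FacialState.cv ε 4)) →
        D'.eval v =
          v FacialState.f₀ * v (FacialState.cv (D'.positive r.crossing) 10) * D.eval v) ∧
    ∀ s S : A, s ^ 5 = 1 → s ^ 4 + s ^ 3 * S + s ^ 2 * S ^ 2 + s * S ^ 3 + S ^ 4 = 0 →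
      FacialState.CurlIdentities (FacialState.assignment s S) ∧
      ∀ (X : Type v) (Y : Type w) [Fintype X] [Fintype Y]
        (D' : FacialState.SurfaceDiagram X) (D : FacialState.SurfaceDiagram Y)
        (r : FacialState.CurlInsertion D' D),
        D'.eval (FacialState.assignment s S) =
          (if D'.positive r.crossing = true then -(s ^ 4 * S) else -(s * S ^ 4)) *
            D.eval (FacialState.assignment s S) := by
  refine ⟨fun v hv X Y _ _ D' D r hr => r.eval_eq hv hr, fun s S hs h => ?_⟩
  have identities := FacialState.curlIdentities_assignment hs h
  have hS : S ^ 5 = 1 := (FacialState.pow_five_eq_pow_five h).trans hs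
  refine ⟨identities, fun X Y _ _ D' D r => ?_⟩
  rw [r.eval_eq identities (.inr (FacialState.assignment_cv_one s S)),
    FacialState.assignment_f₀_mul_cv_ten hs hS]

theorem mainTheorem7 :
    -- general form: the identities make every curl removal a constant factor; a counterclockwise
    -- curl uses in addition that the assignment has `x₁ = x₄` and `X₁ = X₄`
    (∀ (A : Type*) [CommRing A] (v : FacialState.StateVar → A),
      FacialState.CurlIdentities v →
      ∀ (X Y : Type*) [Fintype X] [Fintype Y]
        (D' : FacialState.LinkDiagram X) (D : FacialState.LinkDiagram Y)
        (r : FacialState.CurlRemoval D' D),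
        (r.rotation = FacialState.Rotation.clockwise ∨
          ∀ ε : Bool, v (FacialState.cv ε 1) = v (FacialState.cv ε 4)) →
        D'.eval v =
          v FacialState.f₀ * v (FacialState.cv (D'.positive r.crossing) 10) * D.eval v) ∧
    -- the identities hold in the quotient ring
    FacialState.CurlIdentities (FacialState.assignment FacialState.sHat FacialState.SHat) ∧
    -- the effect of the four types of curls in the quotient ring
    (∀ (X Y : Type*) [Fintype X] [Fintype Y]
        (D' : FacialState.LinkDiagram X) (D : FacialState.LinkDiagram Y)
        (r : FacialState.CurlRemoval D' D),
        D'.eval (FacialState.assignment FacialState.sHat FacialState.SHat) =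
          (if D'.positive r.crossing = true
            then -(FacialState.sHat ^ 4 * FacialState.SHat)
            else -(FacialState.sHat * FacialState.SHat ^ 4)) *
          D.eval (FacialState.assignment FacialState.sHat FacialState.SHat)) :=
  have quot := (mainTheorem7_general _).2 _ _ FacialState.sHat_pow_five
    FacialState.sHat_SHat_homogeneous
  ⟨fun A _ v hv X Y _ _ _ _ r => (mainTheorem7_general A).1 v hv X Y _ _ r.toCurlInsertion,
    quot.1, fun X Y _ _ _ _ r => quot.2 X Y _ _ r.toCurlInsertion⟩
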